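/- All graphs are finite and simple, and $L(G)$ denotes the line graph of $G$. For a graph $G$ and a set $S\subseteq V(G)$ with $|S|\ge 2$, a pendant $S$-Steiner tree is a subgraph $T$ of $G$ that is a tree with $S\subseteq V(T)$ in which every vertex of $S$ has degree one. Let $\tau_G(S)$ be the maximum number of pendant $S$-Steiner trees in $G$ that are pairwise internally disjoint, i.e. $E(T)\cap E(T')=\varnothing$ and $V(T)\cap V(T')=S$ for any two of them, and let $\mu_G(S)$ be the maximum number of pairwise edge-disjoint pendant $S$-Steiner trees in $G$. For $k\ge 2$ put $$\tau_k(G)=\min\{\tau_G(S) : S\subseteq V(G),\ |S|=k\},\qquad \mu_k(G)=\min\{\mu_G(S) : S\subseteq V(G),\ |S|=k\},$$ where both are taken to be $0$ if $|V(G)|<k$. **Proposition.** Let $G$ be a connected graph of order $n$ and let $k$ be an integer with $2\le k\le n$. 1. If $\mu_k(G)\ge 1$, then $\tau_k(L(G))\ge \frac{1}{k+1}\log_2\mu_k(G)$. 2. If $\mu_k(G)\ge 1$, then $\mu_k(L(G))\ge \frac{1}{k+1}\log_2\mu_k(G)$. 3. If $\tau_k(G)\ge 2$, then $\tau_k(L(L(G)))\ge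 \frac{1}{k+1}\bigl(1+\log_2(\tau_k(G)-1)\bigr)$. -/

import Mathlib

namespace SimpleGraph

variable {V : Type*}

/-- `T` is a pendant `S`-Steiner tree of `G`: a subgraph of `G` that is a tree, contains all
vertices of `S`, and in which every vertex of `S` has degree one. -/
def IsPendantSteinerTree (G : SimpleGraph V) (S : Finset V) (T : G.Subgraph) : Prop :=
  T.coe.IsTree ∧ (S : Set V) ⊆ T.verts ∧ ∀ v ∈ S, (T.neighborSet v).ncard = 1

/-- Edge-disjoint subgraphs. -/
def EdgeDisjointTrees (G : SimpleGraph V) (T T' : G.Subgraph) : Prop :=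
  T.edgeSet ∩ T'.edgeSet = ∅

/-- Internally disjoint `S`-Steiner trees: no common edge, and no common vertex outside `S`. -/
def InternallyDisjointTrees (G : SimpleGraph V) (S : Finset V) (T T' : G.Subgraph) : Prop :=
  T.edgeSet ∩ T'.edgeSet = ∅ ∧ T.verts ∩ T'.verts = (S : Set V)

/-- `τ_G(S)`: the maximum number of (pairwise) internally disjoint pendant `S`-Steiner trees of a
finite graph `G`. -/
noncomputable def pendantTreeLocalConn (G : SimpleGraph V) (S : Finset V) : ℕ :=
  sSup {l : ℕ | ∃ F : Finset G.Subgraph, F.card = l ∧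
    (∀ T ∈ F, G.IsPendantSteinerTree S T) ∧
    (F : Set G.Subgraph).Pairwise (G.InternallyDisjointTrees S)}

/-- `μ(S)`: the maximum number of (pairwise) edge-disjoint pendant `S`-Steiner trees of a
finite graph `G`. -/
noncomputable def pendantTreeLocalEdgeConn (G : SimpleGraph V) (S : Finset V) : ℕ :=
  sSup {l : ℕ | ∃ F : Finset G.Subgraph, F.card = l ∧
    (∀ T ∈ F, G.IsPendantSteinerTree S T) ∧
    (F : Set G.Subgraph).Pairwise G.EdgeDisjointTrees}

/-- `τ_k(G)`, the pendant-tree `k`-connectivity: the minimum of `τ_G(S)` over all `k`-subsets `S`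
of the vertex set (and `0` if there is no `k`-subset). -/
noncomputable def pendantTreeConn (k : ℕ) (G : SimpleGraph V) : ℕ :=
  sInf {t : ℕ | ∃ S : Finset V, S.card = k ∧ G.pendantTreeLocalConn S = t}

/-- `μ_k(G)`, the pendant-tree `k`-edge-connectivity: the minimum of `μ(S)` over all `k`-subsets
`S` of the vertex set (and `0` if there is no `k`-subset). -/
noncomputable def pendantTreeEdgeConn (k : ℕ) (G : SimpleGraph V) : ℕ :=
  sInf {t : ℕ | ∃ S : Finset V, S.card = k ∧ G.pendantTreeLocalEdgeConn S = t}

end SimpleGraph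

/-! Two facts give every bound: a linear loss and positivity. Linear loss: given a set `S` of `k`
edges of `G`, pick an endpoint of each and extend to a `k`-set `X`. At most `k` of the edge-disjoint
pendant `X`-trees use an edge of `S`. The edge set of any other tree is connected in `L(G)`, avoids
`S` and dominates `S`, so attaching `S` as leaves gives a pendant `S`-tree. Disjoint edge sets
become disjoint vertex sets, whence `τ_k(L(G)) ≥ μ_k(G) - k`. Positivity, when `μ_k(G) ≥ 2`: for `k
= 2` connectedness of the line graph suffices. For `k ≥ 3`, `G` stays connected after deleting any
`k` edges, so `G` minus `S` plays the role of the tree above. This robustness passes to `L(G)`,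
which settles `L(L(G))`. With `t ≥ 1` trees, `μ ≤ t + k ≤ (k+1)t < 2^((k+1)t)`; two line graphs lose
`2k` instead. -/

namespace SimpleGraph

/-! ### Pendant Steiner trees from connected subgraphs -/

/-- A set closed under adjacency in a connected subgraph contains all its vertices as soon as it
contains one of them. -/
theorem Subgraph.Connected.mem_of_closed {V : Type*} {G : SimpleGraph V} {T : G.Subgraph}
    (hT : T.Connected) {W : Set V} (hW : ∀ u w, T.Adj u w → u ∈ W → w ∈ W) {a b : V}
    (ha : a ∈ T.verts) (hb : b ∈ T.verts) (haW : a ∈ W) : b ∈ W := by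
  by_contra hbW
  obtain ⟨p⟩ := hT.coe.preconnected ⟨a, ha⟩ ⟨b, hb⟩
  obtain ⟨d, -, h1, h2⟩ := p.exists_boundary_dart {x | (x : V) ∈ W} haW hbW
  exact h2 (hW _ _ d.adj h1)

/-- A vertex of a connected subgraph with at least one other vertex has a neighbour. -/
theorem Subgraph.Connected.exists_adj_of_ne {V : Type*} {G : SimpleGraph V} {T : G.Subgraph}
    (hT : T.Connected) {a b : V} (ha : a ∈ T.verts) (hb : b ∈ T.verts) (hab : a ≠ b) :
    ∃ y, T.Adj a y := by
  by_contra! h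
  refine hab (hT.mem_of_closed (W := {a}) (fun u w huw hu => ?_) ha hb rfl).symm
  obtain rfl : u = a := hu
  exact absurd huw (h w)

/-- In a connected subgraph where every vertex of `S` has only one neighbour, a spanning tree is a
pendant `S`-Steiner tree. -/
theorem exists_isPendantSteinerTree_le {V : Type*} {G : SimpleGraph V} {K : G.Subgraph}
    (hK : K.Connected) {S : Finset V} (hS : (S : Set V) ⊆ K.verts)
    (huniq : ∀ s ∈ S, ∃ y, ∀ z, K.Adj s z → z = y) (hnt : K.verts.Nontrivial) :
    ∃ T : G.Subgraph, T ≤ K ∧ T.verts = K.verts ∧ G.IsPendantSteinerTree S T := by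
  obtain ⟨T₀, hle, hT₀⟩ := hK.coe.exists_isTree_le
  let T : G.Subgraph :=
    { verts := K.verts
      Adj := fun x y => ∃ hx hy, T₀.Adj ⟨x, hx⟩ ⟨y, hy⟩
      adj_sub := fun ⟨_, _, h⟩ => K.adj_sub (hle h)
      edge_vert := fun ⟨hx, _, _⟩ => hx
      symm := ⟨fun _ _ ⟨hx, hy, h⟩ => ⟨hy, hx, h.symm⟩⟩ }
  have hcoe : T.coe = T₀ := by
    ext x y
    exact ⟨fun ⟨_, _, h⟩ => h, fun h => ⟨x.2, y.2, h⟩⟩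
  have hTK : T ≤ K := ⟨le_rfl, fun x y ⟨_, _, h⟩ => hle h⟩
  have htree : T.coe.IsTree := hcoe ▸ hT₀
  refine ⟨T, hTK, rfl, htree, hS, fun s hs => ?_⟩
  obtain ⟨y, hy⟩ := huniq s hs
  obtain ⟨b, hb, hbs⟩ := hnt.exists_ne s
  obtain ⟨z, hz⟩ := Subgraph.Connected.exists_adj_of_ne (T := T) ⟨htree.connected⟩ (hS hs) hb
    hbs.symm
  rw [Set.ncard_eq_one]
  refine ⟨z, Set.eq_singleton_iff_unique_mem.2 ⟨hz, fun w hw => ?_⟩⟩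
  rw [hy w (hTK.2 hw), hy z (hTK.2 hz)]

/-- A connected vertex set disjoint from `S` and dominating `S` extends to a pendant `S`-Steiner
tree. -/
theorem exists_isPendantSteinerTree_of_dominating {V : Type*} {G : SimpleGraph V} {S : Finset V}
    {C : Set V} (hC : (G.induce C).Connected) (hSne : S.Nonempty) (hCS : ∀ c ∈ C, c ∉ S)
    (hdom : ∀ s ∈ S, ∃ c ∈ C, G.Adj s c) :
    ∃ T : G.Subgraph, G.IsPendantSteinerTree S T ∧ T.verts = C ∪ S ∧
      ∀ x y, T.Adj x y → x ∈ C ∨ y ∈ C := by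
  choose! f hfC hf using hdom
  -- Each terminal keeps only its edge to one chosen neighbour in `C`. Edges inside `S` are dropped,
  -- so every terminal is a leaf and every edge touches `C`.
  let K : G.Subgraph :=
    { verts := C ∪ S
      Adj := fun x y => G.Adj x y ∧ ((x ∈ C ∧ y ∈ C) ∨ (x ∈ S ∧ y = f x) ∨ (y ∈ S ∧ x = f y))
      adj_sub := fun h => h.1
      edge_vert := by
        rintro x y ⟨-, ⟨h, -⟩ | ⟨h, -⟩ | ⟨h, rfl⟩⟩
        · exact Or.inl h
        · exact Or.inr h
        · exact Or.inl (hfC _ h)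
      symm := ⟨by
        rintro x y ⟨h, h'⟩
        refine ⟨h.symm, ?_⟩
        tauto⟩ }
  have hleaf : ∀ s ∈ S, ∀ z, K.Adj s z → z = f s := by
    rintro s hs z ⟨-, ⟨h, -⟩ | ⟨-, h⟩ | ⟨h, rfl⟩⟩
    · exact absurd hs (hCS _ h)
    · exact h
    · exact absurd hs (hCS _ (hfC _ h))
  have hreach : ∀ x y : C, K.coe.Reachable ⟨x, Or.inl x.2⟩ ⟨y, Or.inl y.2⟩ := fun x y =>
    (hC.preconnected x y).map
      (⟨fun c => ⟨c, Or.inl c.2⟩, fun {a b} h => ⟨h, Or.inl ⟨a.2, b.2⟩⟩⟩ : G.induce C →g K.coe)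
  have htoC : ∀ x : K.verts, ∃ c : C, K.coe.Reachable x ⟨c, Or.inl c.2⟩ := by
    rintro ⟨x, hx | hx⟩
    · exact ⟨⟨x, hx⟩, .rfl⟩
    · exact ⟨⟨f x, hfC x hx⟩, Adj.reachable ⟨hf x hx, Or.inr (Or.inl ⟨hx, rfl⟩)⟩⟩
  obtain ⟨c₀⟩ := hC.nonempty
  obtain ⟨s₀, hs₀⟩ := hSne
  have hK : K.Connected := ⟨{
    preconnected := fun x y => by
      obtain ⟨c, hc⟩ := htoC x
      obtain ⟨d, hd⟩ := htoC y
      exact (hc.trans (hreach c d)).trans hd.symm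
    nonempty := ⟨⟨c₀, Or.inl c₀.2⟩⟩ }⟩
  obtain ⟨T, hTK, hTv, hT⟩ := exists_isPendantSteinerTree_le hK (S := S) (fun s hs => Or.inr hs)
    (fun s hs => ⟨f s, hleaf s hs⟩)
    ⟨c₀, Or.inl c₀.2, s₀, Or.inr hs₀, fun h => hCS _ c₀.2 (h ▸ hs₀)⟩
  refine ⟨T, hT, hTv, fun x y hxy => ?_⟩
  obtain ⟨-, ⟨h, -⟩ | ⟨h, rfl⟩ | ⟨h, rfl⟩⟩ := hTK.2 hxy
  · exact Or.inl h
  · exact Or.inr (hfC _ h)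
  · exact Or.inl (hfC _ h)

/-- In a connected graph any two vertices are joined by a path, which is a pendant Steiner tree. -/
theorem Connected.exists_isPendantSteinerTree_of_card_eq_two {V : Type*} {G : SimpleGraph V}
    (hG : G.Connected) {S : Finset V} (hS : S.card = 2) :
    ∃ T : G.Subgraph, G.IsPendantSteinerTree S T := by
  classical
  obtain ⟨x, y, hxy, rfl⟩ := Finset.card_eq_two.1 hS
  obtain ⟨p, hp⟩ := (hG.preconnected x y).exists_isPath
  have hnil : ¬ p.Nil := fun h => hxy h.eq
  have hx := p.start_mem_verts_toSubgraph
  have hy := p.end_mem_verts_toSubgraph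
  obtain ⟨T, -, -, hT⟩ := exists_isPendantSteinerTree_le p.toSubgraph_connected (S := {x, y})
    (by intro z hz; simp at hz; rcases hz with rfl | rfl <;> assumption)
    (by
      intro s hs
      simp only [Finset.mem_insert, Finset.mem_singleton] at hs
      rcases hs with rfl | rfl
      · refine ⟨p.snd, fun z hz => ?_⟩
        have : z ∈ p.toSubgraph.neighborSet s := hz
        rwa [hp.neighborSet_toSubgraph_startpoint hnil] at this
      · refine ⟨p.penultimate, fun z hz => ?_⟩
        have : z ∈ p.toSubgraph.neighborSet s := hz
        rwa [hp.neighborSet_toSubgraph_endpoint hnil] at this)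
    ⟨x, hx, y, hy, hxy⟩
  exact ⟨T, hT⟩

/-! ### Transfer to the line graph -/

/-- The edges of a connected subgraph form a preconnected vertex set of the line graph. -/
theorem Subgraph.Connected.preconnected_induce_lineGraph {V : Type*} {G : SimpleGraph V}
    {T : G.Subgraph} (hT : T.Connected) :
    (G.lineGraph.induce {e : G.edgeSet | (e : Sym2 V) ∈ T.edgeSet}).Preconnected := by
  set C := {e : G.edgeSet | (e : Sym2 V) ∈ T.edgeSet} with hC
  have hshare : ∀ (e f : C) (u : V), u ∈ (e.1.1 : Sym2 V) → u ∈ (f.1.1 : Sym2 V) →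
      (G.lineGraph.induce C).Reachable e f := by
    intro e f u he hf
    by_cases h : e = f
    · exact h ▸ .rfl
    · refine Adj.reachable ?_
      change G.lineGraph.Adj e.1 f.1
      rw [lineGraph_adj_iff_exists]
      exact ⟨fun h' => h (Subtype.ext h'), u, he, hf⟩
  have hwalk : ∀ (u w : T.verts) (p : T.coe.Walk u w) (e f : C), (u : V) ∈ (e.1.1 : Sym2 V) →
      (w : V) ∈ (f.1.1 : Sym2 V) → (G.lineGraph.induce C).Reachable e f := by
    intro u w p
    induction p with
    | nil => exact fun e f he hf => hshare e f _ he hf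
    | @cons u v w h p ih =>
      intro e f he hf
      have h' : T.Adj u v := h
      let g : C := ⟨⟨s(u, v), h'.adj_sub⟩, h'⟩
      exact (hshare e g u he (Sym2.mem_mk_left _ _)).trans (ih g f (Sym2.mem_mk_right _ _) hf)
  rintro ⟨⟨e, he⟩, heT⟩ ⟨⟨f, hf⟩, hfT⟩
  induction e with | _ a b =>
  induction f with | _ c d =>
  have ha : a ∈ T.verts := T.edge_vert heT
  have hc : c ∈ T.verts := T.edge_vert hfT
  obtain ⟨p⟩ := hT.coe.preconnected ⟨a, ha⟩ ⟨c, hc⟩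
  exact hwalk _ _ p _ _ (Sym2.mem_mk_left _ _) (Sym2.mem_mk_left _ _)

/-- A connected subgraph avoiding the edges of `S`, with an edge meeting each edge of `S`, gives a
pendant `S`-Steiner tree of the line graph. -/
theorem Subgraph.Connected.exists_isPendantSteinerTree_lineGraph {V : Type*} {G : SimpleGraph V}
    {T : G.Subgraph} (hT : T.Connected) {S : Finset G.edgeSet} (hSne : S.Nonempty)
    (havoid : ∀ e ∈ S, (e : Sym2 V) ∉ T.edgeSet)
    (hmeet : ∀ e ∈ S, ∃ u ∈ (e : Sym2 V), ∃ w, T.Adj u w) :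
    ∃ T' : G.lineGraph.Subgraph, G.lineGraph.IsPendantSteinerTree S T' ∧
      T'.verts = {e : G.edgeSet | (e : Sym2 V) ∈ T.edgeSet} ∪ S ∧
      ∀ x y, T'.Adj x y → (x : Sym2 V) ∈ T.edgeSet ∨ (y : Sym2 V) ∈ T.edgeSet := by
  have hdom : ∀ e ∈ S, ∃ f ∈ {e : G.edgeSet | (e : Sym2 V) ∈ T.edgeSet},
      G.lineGraph.Adj e f := by
    intro e he
    obtain ⟨u, hu, w, huw⟩ := hmeet e he
    refine ⟨⟨s(u, w), huw.adj_sub⟩, huw, ?_⟩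
    rw [lineGraph_adj_iff_exists]
    refine ⟨?_, u, hu, Sym2.mem_mk_left _ _⟩
    rintro rfl
    exact havoid _ he huw
  obtain ⟨s, hs⟩ := hSne
  obtain ⟨f, hf, -⟩ := hdom s hs
  exact exists_isPendantSteinerTree_of_dominating
    { preconnected := hT.preconnected_induce_lineGraph, nonempty := ⟨⟨f, hf⟩⟩ } ⟨s, hs⟩
    (fun c hc hcS => havoid c hcS hc) hdom


/-! ### Extremal families behind `sSup` and `sInf` -/

/-- A finite graph has finitely many subgraphs, so the supremum is attained. -/
theorem exists_family_of_pendantTreeConn {V : Type*} [Finite V] (G : SimpleGraph V)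
    (S : Finset V) :
    ∃ F : Finset G.Subgraph, G.pendantTreeConn S.card ≤ F.card ∧
      (∀ T ∈ F, G.IsPendantSteinerTree S T) ∧
      (F : Set G.Subgraph).Pairwise (G.InternallyDisjointTrees S) := by
  have := Fintype.ofFinite G.Subgraph
  have hmem := Nat.sSup_mem (s := {l : ℕ | ∃ F : Finset G.Subgraph, F.card = l ∧
    (∀ T ∈ F, G.IsPendantSteinerTree S T) ∧
    (F : Set G.Subgraph).Pairwise (G.InternallyDisjointTrees S)}) ⟨0, ∅, by simp⟩
    ⟨Fintype.card G.Subgraph, by rintro l ⟨F, rfl, -⟩; exact F.card_le_univ⟩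
  obtain ⟨F, hF, h⟩ := hmem
  refine ⟨F, le_trans ?_ hF.ge, h⟩
  exact Nat.sInf_le ⟨S, rfl, rfl⟩

theorem exists_family_of_pendantTreeEdgeConn {V : Type*} [Finite V] (G : SimpleGraph V)
    (S : Finset V) :
    ∃ F : Finset G.Subgraph, G.pendantTreeEdgeConn S.card ≤ F.card ∧
      (∀ T ∈ F, G.IsPendantSteinerTree S T) ∧
      (F : Set G.Subgraph).Pairwise G.EdgeDisjointTrees := by
  have := Fintype.ofFinite G.Subgraph
  have hmem := Nat.sSup_mem (s := {l : ℕ | ∃ F : Finset G.Subgraph, F.card = l ∧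
    (∀ T ∈ F, G.IsPendantSteinerTree S T) ∧
    (F : Set G.Subgraph).Pairwise G.EdgeDisjointTrees}) ⟨0, ∅, by simp⟩
    ⟨Fintype.card G.Subgraph, by rintro l ⟨F, rfl, -⟩; exact F.card_le_univ⟩
  obtain ⟨F, hF, h⟩ := hmem
  refine ⟨F, le_trans ?_ hF.ge, h⟩
  exact Nat.sInf_le ⟨S, rfl, rfl⟩

/-- The bound on `k` guarantees that some `k`-subset exists; otherwise the infimum would be the
default value `0`. -/
theorem le_pendantTreeConn {V : Type*} [Finite V] {G : SimpleGraph V} {k m : ℕ}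
    (hk : k ≤ Nat.card V)
    (h : ∀ S : Finset V, S.card = k → ∃ F : Finset G.Subgraph, m ≤ F.card ∧
      (∀ T ∈ F, G.IsPendantSteinerTree S T) ∧
      (F : Set G.Subgraph).Pairwise (G.InternallyDisjointTrees S)) :
    m ≤ G.pendantTreeConn k := by
  have := Fintype.ofFinite V
  have := Fintype.ofFinite G.Subgraph
  rw [Nat.card_eq_fintype_card] at hk
  obtain ⟨S, -, hS⟩ := Finset.exists_subset_card_eq (s := (Finset.univ : Finset V)) hk
  refine le_csInf ⟨_, S, hS, rfl⟩ ?_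
  rintro _ ⟨S, hS, rfl⟩
  obtain ⟨F, hm, hF⟩ := h S hS
  refine hm.trans (le_csSup ⟨Fintype.card G.Subgraph, ?_⟩ ⟨F, rfl, hF⟩)
  rintro l ⟨F, rfl, -⟩
  exact F.card_le_univ

theorem le_pendantTreeEdgeConn {V : Type*} [Finite V] {G : SimpleGraph V} {k m : ℕ}
    (hk : k ≤ Nat.card V)
    (h : ∀ S : Finset V, S.card = k → ∃ F : Finset G.Subgraph, m ≤ F.card ∧
      (∀ T ∈ F, G.IsPendantSteinerTree S T) ∧
      (F : Set G.Subgraph).Pairwise G.EdgeDisjointTrees) :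
    m ≤ G.pendantTreeEdgeConn k := by
  have := Fintype.ofFinite V
  have := Fintype.ofFinite G.Subgraph
  rw [Nat.card_eq_fintype_card] at hk
  obtain ⟨S, -, hS⟩ := Finset.exists_subset_card_eq (s := (Finset.univ : Finset V)) hk
  refine le_csInf ⟨_, S, hS, rfl⟩ ?_
  rintro _ ⟨S, hS, rfl⟩
  obtain ⟨F, hm, hF⟩ := h S hS
  refine hm.trans (le_csSup ⟨Fintype.card G.Subgraph, ?_⟩ ⟨F, rfl, hF⟩)
  rintro l ⟨F, rfl, -⟩
  exact F.card_le_univ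

theorem one_le_pendantTreeConn {V : Type*} [Finite V] {G : SimpleGraph V} {k : ℕ}
    (hk : k ≤ Nat.card V)
    (h : ∀ S : Finset V, S.card = k → ∃ T : G.Subgraph, G.IsPendantSteinerTree S T) :
    1 ≤ G.pendantTreeConn k :=
  le_pendantTreeConn hk fun S hS => by
    obtain ⟨T, hT⟩ := h S hS
    exact ⟨{T}, by simp, by simpa using hT, by simp⟩

theorem pendantTreeConn_le_pendantTreeEdgeConn {V : Type*} [Finite V] (G : SimpleGraph V)
    {k : ℕ} (hk : k ≤ Nat.card V) : G.pendantTreeConn k ≤ G.pendantTreeEdgeConn k :=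
  le_pendantTreeEdgeConn hk fun S hS => by
    obtain ⟨F, hF, hT, hd⟩ := G.exists_family_of_pendantTreeConn S
    exact ⟨F, hS ▸ hF, hT, fun T hT T' hT' hne => (hd hT hT' hne).1⟩

theorem IsPendantSteinerTree.connected {V : Type*} {G : SimpleGraph V} {S : Finset V}
    {T : G.Subgraph} (hT : G.IsPendantSteinerTree S T) : T.Connected :=
  ⟨hT.1.connected⟩

theorem IsPendantSteinerTree.exists_adj {V : Type*} {G : SimpleGraph V} {S : Finset V}
    {T : G.Subgraph} (hT : G.IsPendantSteinerTree S T) {s : V} (hs : s ∈ S) :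
    ∃ y, T.Adj s y ∧ ∀ z, T.Adj s z → z = y := by
  obtain ⟨y, hy⟩ := Set.ncard_eq_one.1 (hT.2.2 s hs)
  refine ⟨y, ?_, fun z hz => ?_⟩
  · exact (hy ▸ Set.mem_singleton y : y ∈ T.neighborSet s)
  · exact (hy ▸ hz : z ∈ ({y} : Set V))

/-- For at least three terminals, no two terminals are adjacent in a pendant Steiner tree. -/
theorem IsPendantSteinerTree.not_adj {V : Type*} {G : SimpleGraph V} {S : Finset V}
    {T : G.Subgraph} (hT : G.IsPendantSteinerTree S T) (hS : 3 ≤ S.card) {x y : V} (hx : x ∈ S)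
    (hy : y ∈ S) : ¬ T.Adj x y := by
  classical
  intro hxy
  obtain ⟨z, hz, hzn⟩ := Finset.exists_mem_notMem_of_card_lt_card
    (Finset.card_le_two.trans_lt hS : ({x, y} : Finset V).card < S.card)
  refine hzn ?_
  have := hT.connected.mem_of_closed (W := {w | w = x ∨ w = y}) (fun u w huw hu => ?_)
    (hT.2.1 hx) (hT.2.1 hz) (Or.inl rfl)
  · simpa using this
  · obtain ⟨a, -, ha⟩ := hT.exists_adj hx
    obtain ⟨b, -, hb⟩ := hT.exists_adj hy
    obtain rfl | rfl := hu
    · exact Or.inr ((ha _ huw).trans (ha _ hxy).symm)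
    · exact Or.inl ((hb _ huw).trans (hb _ hxy.symm).symm)

/-! ### The linear bound -/

/-- Passing to the line graph lowers the number of trees by at most `k`, and makes edge-disjoint
trees internally disjoint. -/
theorem pendantTreeEdgeConn_le_pendantTreeConn_lineGraph_add {V : Type*} [Finite V]
    (G : SimpleGraph V) {k : ℕ} (hk : 1 ≤ k) (hkV : k ≤ Nat.card V)
    (hkE : k ≤ Nat.card G.edgeSet) :
    G.pendantTreeEdgeConn k - k ≤ G.lineGraph.pendantTreeConn k := by
  classical
  refine le_pendantTreeConn hkE fun S hS => ?_
  have := Fintype.ofFinite V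
  have hSne : S.Nonempty := Finset.card_pos.1 (by omega)
  let c : G.edgeSet → V := fun e => e.1.out.1
  have hc : ∀ e : G.edgeSet, c e ∈ (e : Sym2 V) := fun e => Sym2.out_fst_mem _
  -- Chosen endpoints of different edges may coincide, so the image is padded to exactly `k`
  -- vertices.
  obtain ⟨X, hX, -, hXk⟩ := Finset.exists_subsuperset_card_eq (s := S.image c) (t := Finset.univ)
    (n := k) (Finset.subset_univ _) (hS ▸ Finset.card_image_le)
    (by rwa [Finset.card_univ, ← Nat.card_eq_fintype_card])
  obtain ⟨F, hF, hT, hd⟩ := G.exists_family_of_pendantTreeEdgeConn X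
  rw [hXk] at hF
  have hdis : ∀ T ∈ F, ∀ T' ∈ F, ∀ e, e ∈ T.edgeSet → e ∈ T'.edgeSet → T = T' := by
    intro T hTF T' hTF' e he he'
    by_contra hne
    exact (Set.eq_empty_iff_forall_notMem.1 (hd hTF hTF' hne)) e ⟨he, he'⟩
  let good : G.Subgraph → Prop := fun T => ∀ e ∈ S, (e : Sym2 V) ∉ T.edgeSet
  -- Sending a bad tree to an edge of `S` it uses is injective by edge-disjointness.
  have hbad : (F.filter fun T => ¬ good T).card ≤ k := by
    rw [← hS]
    have : Nonempty G.edgeSet := ⟨hSne.choose⟩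
    have : ∀ T ∈ F.filter fun T => ¬ good T, ∃ e ∈ S, (e : Sym2 V) ∈ T.edgeSet := by
      intro T hT
      simpa [good] using (Finset.mem_filter.1 hT).2
    choose! g hgS hg using this
    refine Finset.card_le_card_of_injOn g hgS fun T hT T' hT' h => ?_
    refine hdis T (Finset.mem_filter.1 hT).1 T' (Finset.mem_filter.1 hT').1 _ (hg T hT) ?_
    rw [h]
    exact hg T' hT'
  have hsum := Finset.card_filter_add_card_filter_not (s := F) good
  have hex : ∀ T ∈ F.filter good, ∃ T' : G.lineGraph.Subgraph,
      G.lineGraph.IsPendantSteinerTree S T' ∧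
      T'.verts = {e : G.edgeSet | (e : Sym2 V) ∈ T.edgeSet} ∪ S ∧
      ∀ x y, T'.Adj x y → (x : Sym2 V) ∈ T.edgeSet ∨ (y : Sym2 V) ∈ T.edgeSet := by
    intro T hTF
    obtain ⟨hTF, hgood⟩ := Finset.mem_filter.1 hTF
    refine (hT T hTF).connected.exists_isPendantSteinerTree_lineGraph hSne hgood fun e he => ?_
    obtain ⟨y, hy, -⟩ := (hT T hTF).exists_adj (hX (Finset.mem_image_of_mem c he))
    exact ⟨_, hc e, y, hy⟩
  choose! f hf hfv hfe using hex
  have hkey : ∀ T ∈ F.filter good, ∀ T' ∈ F.filter good, T ≠ T' →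
      G.lineGraph.InternallyDisjointTrees S (f T) (f T') := by
    intro T hTF T' hTF' hne
    have hno : ∀ e, e ∈ T.edgeSet → e ∉ T'.edgeSet := fun e he he' =>
      hne (hdis T (Finset.mem_filter.1 hTF).1 T' (Finset.mem_filter.1 hTF').1 e he he')
    -- Every edge of `f T` has an endpoint that is an edge of `T`. Such an endpoint never lies in `f
    -- T'`, which yields both halves of internal disjointness.
    have hvert : ∀ x : G.edgeSet, (x : Sym2 V) ∈ T.edgeSet → x ∉ (f T').verts := by
      intro x hx hx'
      rw [hfv T' hTF'] at hx'
      obtain hx' | hx' := hx'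
      · exact hno _ hx hx'
      · exact (Finset.mem_filter.1 hTF).2 x hx' hx
    constructor
    · refine Set.eq_empty_iff_forall_notMem.2 ?_
      rintro e ⟨he, he'⟩
      induction e with | _ x y =>
      obtain h | h := hfe T hTF x y he
      · exact hvert x h ((f T').edge_vert he')
      · exact hvert y h ((f T').edge_vert ((f T').symm.symm _ _ he'))
    · ext x
      constructor
      · rintro ⟨hx, hx'⟩
        rw [hfv T hTF] at hx
        obtain hx | hx := hx
        · exact absurd hx' (hvert x hx)
        · exact hx
      · exact fun hx => ⟨(hf T hTF).2.1 hx, (hf T' hTF').2.1 hx⟩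
  -- If two trees had the same image, that image would be edge-disjoint from itself, although it has
  -- an edge at each terminal.
  have hinj : Set.InjOn f (F.filter good) := by
    intro T hTF T' hTF' h
    by_contra hne
    have h1 := (hkey T hTF T' hTF' hne).1
    rw [h, Set.inter_self] at h1
    obtain ⟨s, hs⟩ := hSne
    obtain ⟨y, hy, -⟩ := (hf T' hTF').exists_adj hs
    exact Set.eq_empty_iff_forall_notMem.1 h1 s(s, y) hy
  refine ⟨(F.filter good).image f, ?_, ?_, ?_⟩
  · rw [Finset.card_image_of_injOn hinj]
    omega
  · intro T' hT'
    obtain ⟨T, hT, rfl⟩ := Finset.mem_image.1 hT'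
    exact hf T hT
  · intro T₁ h₁ T₂ h₂ hne
    obtain ⟨T, hT, rfl⟩ := Finset.mem_image.1 h₁
    obtain ⟨T', hT', rfl⟩ := Finset.mem_image.1 h₂
    exact hkey T hT T' hT' fun h => hne (h ▸ rfl)


/-! ### Robustness under deletion of `k` edges, and positivity -/

/-- A connected graph stays connected after deleting edges that do not contain all the edges across
any cut. -/
theorem Connected.deleteEdges_of_forall_cut {V : Type*} {G : SimpleGraph V} (hG : G.Connected)
    {F : Set (Sym2 V)}
    (h : ∀ A : Set V, ∀ a ∈ A, ∀ b ∉ A, G.Adj a b →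
      ∃ x ∈ A, ∃ y ∉ A, G.Adj x y ∧ s(x, y) ∉ F) : (G.deleteEdges F).Connected := by
  have := hG.nonempty
  refine { preconnected := fun u v => ?_ }
  by_contra huv
  obtain ⟨p⟩ := hG.preconnected u v
  obtain ⟨d, -, h1, h2⟩ :=
    p.exists_boundary_dart {w | (G.deleteEdges F).Reachable u w} (Reachable.refl u) huv
  obtain ⟨x, hx, y, hy, hxy, hF⟩ := h _ _ h1 _ h2 d.adj
  exact hy (hx.trans (Adj.reachable (deleteEdges_adj.2 ⟨hxy, hF⟩)))

/-- Two edge-disjoint pendant trees on every `k`-set force every deletion of at most `k` edges to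
leave the graph connected. -/
theorem Connected.deleteEdges_of_two_le_pendantTreeEdgeConn {V : Type*} [Finite V]
    {G : SimpleGraph V} (hG : G.Connected) {k : ℕ} (hk : 3 ≤ k) (hkV : k ≤ Nat.card V)
    (hμ : 2 ≤ G.pendantTreeEdgeConn k) {F : Finset (Sym2 V)} (hF : F.card ≤ k) :
    (G.deleteEdges F).Connected := by
  classical
  have := Fintype.ofFinite V
  refine hG.deleteEdges_of_forall_cut fun A a ha b hb hab => ?_
  by_contra! hcut
  -- The terminal charged to a crossing edge is its end in `A`, unless that end is `a`, which is a
  -- terminal anyway; then it is the other end. Non-crossing pairs receive the dummy value `a`.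
  have hc : ∀ e : Sym2 V, ∃ v, ∀ x ∈ A, ∀ y ∉ A, e = s(x, y) → v = if x = a then y else x := by
    intro e
    by_cases he : ∃ x ∈ A, ∃ y ∉ A, e = s(x, y)
    · obtain ⟨x, hx, y, hy, rfl⟩ := he
      refine ⟨if x = a then y else x, fun x' hx' y' hy' h => ?_⟩
      obtain ⟨rfl, rfl⟩ | ⟨rfl, rfl⟩ := Sym2.eq_iff.1 h
      · rfl
      · exact absurd hx hy'
    · exact ⟨a, fun x hx y hy h => absurd ⟨x, hx, y, hy, h⟩ he⟩
  choose c hc using hc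
  have habF : s(a, b) ∈ F := hcut a ha b hb hab
  -- The terminals `a` and `b` use up two of the `k` places, leaving room to charge `k - 2` edges.
  -- The edge `ab` needs no charge, and `e₀` is handled by choosing one of two edge-disjoint trees
  -- that avoids it.
  obtain ⟨e₀, he₀⟩ : ∃ e₀, ((F.erase s(a, b)).erase e₀).card ≤ k - 2 := by
    have h1 := Finset.card_erase_of_mem habF
    obtain h | ⟨e₀, he₀⟩ := (F.erase s(a, b)).eq_empty_or_nonempty
    · exact ⟨s(a, b), by simp [h]⟩
    · exact ⟨e₀, by rw [Finset.card_erase_of_mem he₀]; omega⟩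
  set F' := (F.erase s(a, b)).erase e₀ with hF'
  obtain ⟨X, hX, -, hXk⟩ := Finset.exists_subsuperset_card_eq (s := {a, b} ∪ F'.image c)
    (t := Finset.univ) (n := k) (Finset.subset_univ _)
    ((Finset.card_union_le _ _).trans (by
      have h1 : ({a, b} : Finset V).card ≤ 2 := Finset.card_le_two
      have h2 : (F'.image c).card ≤ F'.card := Finset.card_image_le
      omega))
    (by rwa [Finset.card_univ, ← Nat.card_eq_fintype_card])
  have haX : a ∈ X := hX (by simp)
  have hbX : b ∈ X := hX (by simp)
  obtain ⟨𝓕, h𝓕, hT, hd⟩ := G.exists_family_of_pendantTreeEdgeConn X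
  rw [hXk] at h𝓕
  obtain ⟨T₁, h₁, T₂, h₂, hne⟩ := Finset.one_lt_card.1 (hμ.trans h𝓕)
  obtain ⟨T, hT, he₀T⟩ : ∃ T, G.IsPendantSteinerTree X T ∧ e₀ ∉ T.edgeSet := by
    by_cases h : e₀ ∈ T₁.edgeSet
    · exact ⟨T₂, hT _ h₂, fun h' =>
        Set.eq_empty_iff_forall_notMem.1 (hd h₁ h₂ hne) e₀ ⟨h, h'⟩⟩
    · exact ⟨T₁, hT _ h₁, h⟩
  have hcross : ∀ x ∈ A, ∀ y ∉ A, T.Adj x y → x ∈ X ∧ (x = a → y ∈ X) := by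
    intro x hx y hy hxy
    by_cases h : s(x, y) = s(a, b)
    · obtain ⟨rfl, rfl⟩ | ⟨rfl, rfl⟩ := Sym2.eq_iff.1 h
      · exact ⟨haX, fun _ => hbX⟩
      · exact absurd hx hb
    have hmem : s(x, y) ∈ F' :=
      Finset.mem_erase.2 ⟨fun h' => he₀T (h' ▸ hxy), Finset.mem_erase.2
        ⟨h, hcut x hx y hy hxy.adj_sub⟩⟩
    have hcX : c s(x, y) ∈ X := hX (Finset.mem_union_right _ (Finset.mem_image_of_mem c hmem))
    rw [hc _ x hx y hy rfl] at hcX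
    split_ifs at hcX with hxa
    · exact ⟨hxa ▸ haX, fun _ => hcX⟩
    · exact ⟨hcX, fun h' => absurd h' hxa⟩
  have hleaf : ∀ {x y}, x ∈ X → y ∈ X → ¬ T.Adj x y := fun hx hy =>
    hT.not_adj (hXk ▸ hk) hx hy
  -- `W` consists of the non-terminals in `A` and the terminals hanging from them. A crossing edge
  -- of `T` has its end in `A` in `X`, hence a leaf, so `W` is closed under adjacency in `T`. It
  -- contains `a`: a crossing edge at `a` would join two terminals. So it must contain `b`, whose
  -- edge would then cross from a non-terminal in `A`.
  let W : Set V := {z | (z ∈ A ∧ z ∉ X) ∨ (z ∈ X ∧ ∃ q, T.Adj z q ∧ q ∈ A ∧ q ∉ X)}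
  have hbW : b ∈ W := by
    refine hT.connected.mem_of_closed (W := W) (fun u w huw hu => ?_) (hT.2.1 haX) (hT.2.1 hbX) ?_
    · obtain ⟨huA, huX⟩ | ⟨huX, q, huq, hqA, hqX⟩ := hu
      · by_cases hwX : w ∈ X
        · exact Or.inr ⟨hwX, u, huw.symm, huA, huX⟩
        · refine Or.inl ⟨?_, hwX⟩
          by_contra hwA
          exact huX (hcross u huA w hwA huw).1
      · obtain ⟨y, -, hy⟩ := hT.exists_adj huX
        obtain rfl : w = q := (hy _ huw).trans (hy _ huq).symm
        exact Or.inl ⟨hqA, hqX⟩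
    · obtain ⟨p, hp, -⟩ := hT.exists_adj haX
      have hpX : p ∉ X := fun h => hleaf haX h hp
      refine Or.inr ⟨haX, p, hp, ?_, hpX⟩
      by_contra hpA
      exact hpX ((hcross a ha p hpA hp).2 rfl)
  obtain ⟨hbA, -⟩ | ⟨-, q, hq, hqA, hqX⟩ := hbW
  · exact hb hbA
  · exact hqX (hcross q hqA b hb hq.symm).1

/-- A graph that stays connected after deleting any `k` edges has at least `k + 2` edges. -/
theorem card_add_le_card_edgeSet_of_forall_deleteEdges {V : Type*} [Finite V] {G : SimpleGraph V}
    {k : ℕ} (hV : 3 ≤ Nat.card V)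
    (h : ∀ F : Finset (Sym2 V), F.card ≤ k → (G.deleteEdges F).Connected) :
    k + 2 ≤ Nat.card G.edgeSet := by
  classical
  have := Fintype.ofFinite V
  have hE : Nat.card G.edgeSet = G.edgeFinset.card := by
    rw [Nat.card_eq_fintype_card, edgeFinset_card]
  -- A connected graph on at least three vertices has at least two edges, and these survive the
  -- deletion of `F`.
  have hkey : ∀ F ⊆ G.edgeFinset, F.card ≤ k → F.card + 2 ≤ G.edgeFinset.card := by
    intro F hF hFk
    have h1 := (h F hFk).card_vert_le_card_edgeSet_add_one
    rw [edgeSet_deleteEdges, ← coe_edgeFinset, ← Finset.coe_sdiff, Nat.card_coe_set_eq,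
      Set.ncard_coe_finset, Finset.card_sdiff_of_subset hF] at h1
    have := Finset.card_le_card hF
    omega
  rw [hE]
  obtain hle | hlt := le_total k G.edgeFinset.card
  · obtain ⟨F, hF, rfl⟩ := Finset.exists_subset_card_eq hle
    exact hkey F hF le_rfl
  · have := hkey _ subset_rfl hlt
    omega

/-- Deleting the edges of `S` leaves a connected spanning subgraph, so every edge of `S` still meets
one of its edges, and these edges dominate `S` in the line graph. -/
theorem one_le_pendantTreeConn_lineGraph_of_forall_deleteEdges {V : Type*} [Finite V]
    {G : SimpleGraph V} {k : ℕ} (hk : 1 ≤ k) (hV : 3 ≤ Nat.card V)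
    (h : ∀ F : Finset (Sym2 V), F.card ≤ k → (G.deleteEdges F).Connected) :
    1 ≤ G.lineGraph.pendantTreeConn k := by
  classical
  have hE := card_add_le_card_edgeSet_of_forall_deleteEdges hV h
  refine one_le_pendantTreeConn (by omega) fun S hS => ?_
  have hcard : (S.map (Function.Embedding.subtype _)).card ≤ k := by rw [Finset.card_map, hS]
  have hcon := h _ hcard
  have hT := hcon.toSubgraph (deleteEdges_le _)
  have hadj : ∀ x y, (toSubgraph _ (G.deleteEdges_le
    (S.map (Function.Embedding.subtype _) : Finset (Sym2 V)))).Adj x y ↔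
      G.Adj x y ∧ s(x, y) ∉ S.map (Function.Embedding.subtype _) := fun x y => deleteEdges_adj
  refine (hT.exists_isPendantSteinerTree_lineGraph
    (Finset.card_pos.1 (by omega : 0 < S.card)) (fun e he hmem => ?_) (fun e he => ?_)).imp
      fun _ h => h.1
  · obtain ⟨e, he'⟩ := e
    induction e with | _ x y =>
    exact ((hadj x y).1 hmem).2 (Finset.mem_map_of_mem _ he)
  · obtain ⟨e, he'⟩ := e
    induction e with | _ x y =>
    have hxy : G.Adj x y := he'
    obtain ⟨z, hz⟩ := hT.exists_adj_of_ne (a := x) (b := y) trivial trivial hxy.ne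
    exact ⟨x, Sym2.mem_mk_left _ _, z, hz⟩

/-- Deleting a few vertices of the line graph amounts to deleting edges of the graph. -/
theorem preconnected_induce_compl_lineGraph {V : Type*} [Finite V] {G : SimpleGraph V} {k : ℕ}
    (h : ∀ F : Finset (Sym2 V), F.card ≤ k → (G.deleteEdges F).Connected)
    (S : Finset G.edgeSet) (hS : S.card ≤ k) :
    (G.lineGraph.induce (S : Set G.edgeSet)ᶜ).Preconnected := by
  classical
  have hcard : (S.map (Function.Embedding.subtype _)).card ≤ k := by rwa [Finset.card_map]
  have hT := (h _ hcard).toSubgraph (deleteEdges_le _)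
  have hset : {e : G.edgeSet | (e : Sym2 V) ∈ (toSubgraph _ (G.deleteEdges_le
      (S.map (Function.Embedding.subtype _) : Finset (Sym2 V)))).edgeSet} =
      (S : Set G.edgeSet)ᶜ := by
    ext ⟨e, he⟩
    induction e with | _ x y =>
    have hxy : G.Adj x y := he
    change (G.deleteEdges _).Adj x y ↔ _
    simp [deleteEdges_adj, hxy]
  have := hT.preconnected_induce_lineGraph
  rwa [hset] at this

/-- Robustness against deleting at most `k` vertices implies robustness against deleting at most
`k` edges. -/
theorem connected_deleteEdges_of_forall_induce_compl {V : Type*} [Finite V] {G : SimpleGraph V}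
    {k : ℕ} (hV : k + 2 ≤ Nat.card V)
    (h : ∀ S : Finset V, S.card ≤ k → (G.induce (S : Set V)ᶜ).Preconnected)
    {F : Finset (Sym2 V)} (hF : F.card ≤ k) : (G.deleteEdges F).Connected := by
  classical
  have := Fintype.ofFinite V
  rw [Nat.card_eq_fintype_card] at hV
  have : Nonempty V := Fintype.card_pos_iff.1 (by omega)
  have hcon : G.Connected := by
    refine { preconnected := fun u v => ?_ }
    exact (h ∅ (by simp) ⟨u, by simp⟩ ⟨v, by simp⟩).map (Embedding.induce _).toHom
  refine hcon.deleteEdges_of_forall_cut fun A a₀ ha₀ b₀ hb₀ hab₀ => ?_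
  by_contra! hcut
  -- If all pairs across the cut were adjacent, at least `|V| - 1 ≥ k + 1` edges would cross it,
  -- more than `F` holds.
  have hab : ∃ a ∈ A, ∃ b ∉ A, ¬ G.Adj a b := by
    by_contra! hall
    -- each vertex other than `a₀` gives its own deleted edge
    have hle : (Finset.univ.erase a₀).card ≤ F.card := by
      refine Finset.card_le_card_of_injOn (fun x => if x ∈ A then s(x, b₀) else s(a₀, x))
        (fun x hx => ?_) (fun x hx y hy hxy => ?_)
      · by_cases hxA : x ∈ A
        · simpa [hxA] using hcut x hxA b₀ hb₀ (hall x hxA b₀ hb₀)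
        · simpa [hxA] using hcut a₀ ha₀ x hxA (hall a₀ ha₀ x hxA)
      · have hx' : x ≠ a₀ := (Finset.mem_erase.1 hx).1
        have hy' : y ≠ a₀ := (Finset.mem_erase.1 hy).1
        dsimp only at hxy
        split_ifs at hxy <;> rw [Sym2.eq_iff] at hxy <;> grind
    rw [Finset.card_erase_of_mem (Finset.mem_univ _), Finset.card_univ] at hle
    omega
  obtain ⟨a, ha, b, hb, hnab⟩ := hab
  let F' := F.filter fun e => ∃ x ∈ A, ∃ y ∉ A, G.Adj x y ∧ e = s(x, y)
  -- As `a` and `b` are not adjacent, each crossing edge has an end other than both. Removing these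
  -- at most `k` ends would separate `a` from `b`.
  have hc : ∀ e ∈ F', ∃ v ∈ e, v ≠ a ∧ v ≠ b := by
    intro e he
    obtain ⟨-, x, hx, y, hy, hxy, rfl⟩ := Finset.mem_filter.1 he
    by_cases hxa : x = a
    · exact ⟨y, Sym2.mem_mk_right _ _, fun h => hy (h ▸ ha), fun h => hnab (hxa ▸ h ▸ hxy)⟩
    · exact ⟨x, Sym2.mem_mk_left _ _, hxa, fun h => hb (h ▸ hx)⟩
  choose! c hc hca hcb using hc
  obtain ⟨p⟩ := h (F'.image c)
    (Finset.card_image_le.trans ((Finset.card_filter_le _ _).trans hF))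
    ⟨a, by simpa using fun e he => hca e he⟩ ⟨b, by simpa using fun e he => hcb e he⟩
  obtain ⟨d, -, h1, h2⟩ := p.exists_boundary_dart {z | (z : V) ∈ A} ha hb
  have hd : G.Adj d.fst d.snd := d.adj
  have hmem : s((d.fst : V), (d.snd : V)) ∈ F' :=
    Finset.mem_filter.2 ⟨hcut _ h1 _ h2 hd, _, h1, _, h2, hd, rfl⟩
  have hv := hc _ hmem
  have hin : c s((d.fst : V), (d.snd : V)) ∈ F'.image c := Finset.mem_image_of_mem c hmem
  rcases Sym2.mem_iff.1 hv with h' | h'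
  · exact d.fst.2 (h' ▸ hin)
  · exact d.snd.2 (h' ▸ hin)


/-- Two edge-disjoint trees leave each of their terminals by different edges, so the minimum degree
is at least two; the handshake lemma does the rest. -/
theorem three_le_and_card_le_card_edgeSet {V : Type*} [Finite V] {G : SimpleGraph V} {k : ℕ}
    (hk : 2 ≤ k) (hkV : k ≤ Nat.card V) (hμ : 2 ≤ G.pendantTreeEdgeConn k) :
    3 ≤ Nat.card V ∧ Nat.card V ≤ Nat.card G.edgeSet := by
  classical
  have := Fintype.ofFinite V
  have hE : Nat.card G.edgeSet = G.edgeFinset.card := by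
    rw [Nat.card_eq_fintype_card, edgeFinset_card]
  rw [Nat.card_eq_fintype_card] at hkV ⊢
  have hdeg : ∀ v, 2 ≤ G.degree v := by
    intro v
    obtain ⟨X, hX, -, hXk⟩ := Finset.exists_subsuperset_card_eq (s := {v}) (t := Finset.univ)
      (n := k) (Finset.subset_univ _) (by simp; omega) (by rwa [Finset.card_univ])
    obtain ⟨𝓕, h𝓕, hT, hd⟩ := G.exists_family_of_pendantTreeEdgeConn X
    rw [hXk] at h𝓕
    obtain ⟨T₁, h₁, T₂, h₂, hne⟩ := Finset.one_lt_card.1 (hμ.trans h𝓕)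
    have hv : v ∈ X := hX (by simp)
    obtain ⟨y, hy, -⟩ := (hT _ h₁).exists_adj hv
    obtain ⟨z, hz, -⟩ := (hT _ h₂).exists_adj hv
    refine Finset.one_lt_card.2 ⟨y, by simpa using hy.adj_sub, z, by simpa using hz.adj_sub, ?_⟩
    rintro rfl
    exact Set.eq_empty_iff_forall_notMem.1 (hd h₁ h₂ hne) s(v, y) ⟨hy, hz⟩
  have hsum := G.sum_degrees_eq_twice_card_edges
  have hle := Finset.card_nsmul_le_sum Finset.univ (fun v => G.degree v) 2 fun v _ => hdeg v
  rw [hsum, Finset.card_univ, smul_eq_mul] at hle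
  have : Nonempty V := Fintype.card_pos_iff.1 (by omega)
  have h1 := hdeg (Classical.arbitrary V)
  have h2 := G.degree_lt_card_verts (Classical.arbitrary V)
  exact ⟨by omega, by omega⟩

theorem Connected.lineGraph {V : Type*} {G : SimpleGraph V} (hG : G.Connected)
    (hE : 1 ≤ Nat.card G.edgeSet) : G.lineGraph.Connected := by
  have h := (hG.toSubgraph le_rfl).preconnected_induce_lineGraph
  have hne : Nonempty G.edgeSet := (Nat.card_pos_iff.1 hE).1
  exact { preconnected := fun e f =>
    (h ⟨e, e.2⟩ ⟨f, f.2⟩).map (Embedding.induce _).toHom }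

theorem Connected.one_le_pendantTreeConn_two {V : Type*} [Finite V] {G : SimpleGraph V}
    (hG : G.Connected) (hV : 2 ≤ Nat.card V) : 1 ≤ G.pendantTreeConn 2 :=
  one_le_pendantTreeConn hV fun _ hS => hG.exists_isPendantSteinerTree_of_card_eq_two hS

theorem Connected.one_le_pendantTreeConn_lineGraph {V : Type*} [Finite V] {G : SimpleGraph V}
    (hG : G.Connected) {k : ℕ} (hk : 2 ≤ k) (hkV : k ≤ Nat.card V)
    (hμ : 2 ≤ G.pendantTreeEdgeConn k) : 1 ≤ G.lineGraph.pendantTreeConn k := by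
  obtain ⟨h3, hE⟩ := three_le_and_card_le_card_edgeSet hk hkV hμ
  obtain rfl | hk := hk.eq_or_lt
  · exact (hG.lineGraph (by omega)).one_le_pendantTreeConn_two (by omega)
  · exact one_le_pendantTreeConn_lineGraph_of_forall_deleteEdges (by omega) h3
      fun F hF => hG.deleteEdges_of_two_le_pendantTreeEdgeConn hk hkV hμ hF

/-- The single-step result cannot simply be iterated, since it gives only one tree in `L(G)` and
needs two. For `k ≥ 3` robustness is carried over instead: vertex deletions in `L(G)` are edge
deletions in `G`, and vertex robustness implies edge robustness. -/
theorem Connected.one_le_pendantTreeConn_lineGraph_lineGraph {V : Type*} [Finite V]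
    {G : SimpleGraph V} (hG : G.Connected) {k : ℕ} (hk : 2 ≤ k) (hkV : k ≤ Nat.card V)
    (hμ : 2 ≤ G.pendantTreeEdgeConn k) : 1 ≤ G.lineGraph.lineGraph.pendantTreeConn k := by
  obtain ⟨h3, hE⟩ := three_le_and_card_le_card_edgeSet hk hkV hμ
  obtain rfl | hk := hk.eq_or_lt
  · have hL := hG.lineGraph (by omega)
    have hLE := hL.card_vert_le_card_edgeSet_add_one
    exact (hL.lineGraph (by omega)).one_le_pendantTreeConn_two (by omega)
  · have hcut : ∀ F : Finset (Sym2 V), F.card ≤ k → (G.deleteEdges F).Connected :=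
      fun F hF => hG.deleteEdges_of_two_le_pendantTreeEdgeConn hk hkV hμ hF
    have hcard := card_add_le_card_edgeSet_of_forall_deleteEdges h3 hcut
    exact one_le_pendantTreeConn_lineGraph_of_forall_deleteEdges (by omega) (by omega)
      fun F hF => connected_deleteEdges_of_forall_induce_compl hcard
        (preconnected_induce_compl_lineGraph hcut) hF

end SimpleGraph

/-! ### Logarithmic bounds -/

theorem Real.logb_two_le_of_le_pow {a n : ℕ} (h : a ≤ 2 ^ n) : Real.logb 2 a ≤ n := by
  obtain rfl | ha := Nat.eq_zero_or_pos a
  -- Here `Real.logb 2 0 = 0` by convention.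
  · simp
  · rw [Real.logb_le_iff_le_rpow (by norm_num) (by exact_mod_cast ha), Real.rpow_natCast]
    exact_mod_cast h

theorem mainTheorem4 {V : Type*} [Fintype V] (G : SimpleGraph V) (hG : G.Connected)
    (k : ℕ) (hk : 2 ≤ k) (hkn : k ≤ Fintype.card V) :
    (1 ≤ G.pendantTreeEdgeConn k →
      (1 / ((k : ℝ) + 1)) * Real.logb 2 (G.pendantTreeEdgeConn k : ℝ)
        ≤ (G.lineGraph.pendantTreeConn k : ℝ)) ∧
    (1 ≤ G.pendantTreeEdgeConn k →
      (G.lineGraph.pendantTreeEdgeConn k : ℝ)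
        ≥ (1 / ((k : ℝ) + 1)) * Real.logb 2 (G.pendantTreeEdgeConn k : ℝ)) ∧
    (2 ≤ G.pendantTreeConn k →
      (G.lineGraph.lineGraph.pendantTreeConn k : ℝ)
        ≥ (1 / ((k : ℝ) + 1)) * (1 + Real.logb 2 ((G.pendantTreeConn k : ℝ) - 1))) := by
  have hkV : k ≤ Nat.card V := by rwa [Nat.card_eq_fintype_card]
  have hpow : k < 2 ^ k := Nat.lt_two_pow_self
  have hscale : ∀ (r : ℝ) (m : ℕ), r ≤ ((k + 1) * m : ℕ) → 1 / ((k : ℝ) + 1) * r ≤ m := by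
    intro r m h
    push_cast at h
    rwa [one_div, inv_mul_le_iff₀ (by positivity)]
  -- Since `t ≥ 1`, `t + k ≤ (k + 1) * t`.
  have key : ∀ {μ t : ℕ}, 2 ≤ μ → 1 ≤ t → μ - k ≤ t → μ ≤ 2 ^ ((k + 1) * t) := by
    intro μ t _ ht hle
    have h1 : (k + 1) * t < 2 ^ ((k + 1) * t) := Nat.lt_two_pow_self
    have h2 : μ ≤ t + k := by omega
    nlinarith
  have part1 : 1 ≤ G.pendantTreeEdgeConn k →
      (1 / ((k : ℝ) + 1)) * Real.logb 2 (G.pendantTreeEdgeConn k : ℝ)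
        ≤ (G.lineGraph.pendantTreeConn k : ℝ) := by
    intro hμ
    refine hscale _ _ (Real.logb_two_le_of_le_pow ?_)
    obtain h | h := hμ.eq_or_lt
    · rw [← h]; exact Nat.one_le_two_pow
    · obtain ⟨-, hE⟩ := SimpleGraph.three_le_and_card_le_card_edgeSet hk hkV h
      exact key h (hG.one_le_pendantTreeConn_lineGraph hk hkV h)
        (G.pendantTreeEdgeConn_le_pendantTreeConn_lineGraph_add (by omega) hkV (by omega))
  refine ⟨part1, fun hμ => ?_, fun hτ => ?_⟩
  · by_cases h : 2 ≤ G.pendantTreeEdgeConn k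
    · obtain ⟨-, hE⟩ := SimpleGraph.three_le_and_card_le_card_edgeSet hk hkV h
      refine (part1 hμ).trans ?_
      exact_mod_cast G.lineGraph.pendantTreeConn_le_pendantTreeEdgeConn (by omega)
    · rw [show G.pendantTreeEdgeConn k = 1 by omega]
      simp
  · have hτμ := G.pendantTreeConn_le_pendantTreeEdgeConn hkV
    have hμ := hτ.trans hτμ
    obtain ⟨-, hE⟩ := SimpleGraph.three_le_and_card_le_card_edgeSet hk hkV hμ
    have h1 := G.pendantTreeEdgeConn_le_pendantTreeConn_lineGraph_add (by omega) hkV (by omega)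
    have h1' := G.lineGraph.pendantTreeConn_le_pendantTreeEdgeConn (k := k) (by omega)
    have h2 := hG.one_le_pendantTreeConn_lineGraph_lineGraph hk hkV hμ
    set τ := G.pendantTreeConn k
    set t := G.lineGraph.lineGraph.pendantTreeConn k
    refine hscale _ _ ?_
    -- The `-1` in the exponent pays for the summand `1 +` in the claim.
    have hbound : τ - 1 ≤ 2 ^ ((k + 1) * t - 1) := by
      -- Up to this threshold `t ≥ 1` suffices, as `τ - 1 ≤ 2k ≤ 2^k`. Beyond it, two linear losses
      -- of `k` leave `t ≥ τ - 2k ≥ 2`, which makes `t + 2k ≤ (k+1)t`.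
      by_cases hbig : τ ≤ 2 * k + 1
      · have h3 : 2 * k ≤ 2 ^ k := by
          obtain ⟨j, rfl⟩ : ∃ j, k = j + 1 := ⟨k - 1, by omega⟩
          have : j < 2 ^ j := Nat.lt_two_pow_self
          rw [pow_succ]; omega
        have h4 : (2 : ℕ) ^ k ≤ 2 ^ ((k + 1) * t - 1) :=
          Nat.pow_le_pow_right (by norm_num) (by have : (k + 1) * 1 ≤ (k + 1) * t := by gcongr
                                                 omega)
        omega
      · obtain ⟨-, hLE⟩ := SimpleGraph.three_le_and_card_le_card_edgeSet hk
          (G := G.lineGraph) (by omega) (by omega)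
        have h3 := G.lineGraph.pendantTreeEdgeConn_le_pendantTreeConn_lineGraph_add
          (k := k) (by omega) (by omega) (by omega)
        have h4 : (k + 1) * t - 1 < 2 ^ ((k + 1) * t - 1) := Nat.lt_two_pow_self
        have h5 : τ ≤ t + 2 * k := by omega
        have h6 : 2 ≤ t := by omega
        have h7 : t + 2 * k ≤ (k + 1) * t := by nlinarith
        omega
    have hlog := Real.logb_two_le_of_le_pow hbound
    have hpos : 1 ≤ (k + 1) * t := Nat.mul_pos (by omega) h2
    push_cast [Nat.cast_sub hpos, Nat.cast_sub (show 1 ≤ τ by omega)] at hlog ⊢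
    linarith
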